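/- \textbf{Theorem.} A \emph{gyrogroup} is a set $G$ with a binary operation $\oplus$ having a two-sided identity $0$ and two-sided inverses $\ominus x$, and such that for all $x,y\in G$ there is an automorphism $\mathrm{gyr}[x,y]$ of $(G,\oplus)$ with $x\oplus(y\oplus z)=(x\oplus y)\oplus \mathrm{gyr}[x,y](z)$ for all $z\in G$ and $\mathrm{gyr}[x\oplus y,y]=\mathrm{gyr}[x,y]$. It is a \emph{topological gyrogroup} if it carries a topology for which $\oplus$ is jointly continuous and $\ominus$ is continuous. A \emph{strongly topological gyrogroup with a symmetric neighborhood base $\mathscr U$ at $0$} is a topological gyrogroup with a neighborhood base $\mathscr U$ at $0$ such that $\ominus U=U$ and $\mathrm{gyr}[x,y](U)=U$ for all $U\in\mathscr U$ and $x,y\in G$. A \emph{subgyrogroup} is a nonempty subset $H$ closed under $\oplus$ and $\ominus$ with $\mathrm{gyr}[a,b](H)=H$ for all $a,b\in H$; it is an \emph{admissible subgyrogroup generated from $\mathscr U$} if there are open symmetric neighborhoods $U_n\in\mathscr U$ $(n\in\omega)$ of $0$ with $U_{n+1}\oplus(U_{n+1}\oplus U_{n+1})\subset U_n$ for all $n$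 and $H=\bigcap_{n\in\omega}U_n$. The set $G/H=\{a\oplus H:a\in G\}$ carries the quotient topology with respect to $a\mapsto a\oplus H$. A space $X$ is \emph{strongly Fr\'echet--Urysohn} if, whenever $(A_n)_n$ is a decreasing sequence of subsets of $X$ and $x\in\bigcap_n\overline{A_n}$, there are $x_n\in A_n$ with $x_n\to x$. Let $G$ be a Hausdorff strongly topological gyrogroup with a symmetric neighborhood base $\mathscr U$ at $0$, and let $H$ be an admissible subgyrogroup of $G$ generated from $\mathscr U$ which is locally compact and metrizable in the subspace topology. If the quotient space $G/H$ is strongly Fr\'echet--Urysohn, then $G$ is strongly Fr\'echet--Urysohn. -/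

import Mathlib

open Set Filter Topology

universe u

/-- A gyrogroup, written additively: `a + b` is `a ⊕ b` and `-a` is `⊖ a`. The operation is in
general neither associative nor commutative. The gyration `gyr x y` is an automorphism of `(G, +)`.
Uniqueness of the identity and of inverses is automatic, see `Gyrogroup.eq_zero_of_identity` and
`Gyrogroup.eq_neg_of_inverse`. -/
class Gyrogroup (G : Type u) extends Zero G, Add G, Neg G where
  zero_oplus : ∀ a : G, 0 + a = a
  oplus_zero : ∀ a : G, a + 0 = a
  neg_oplus : ∀ a : G, -a + a = 0
  oplus_neg : ∀ a : G, a + -a = 0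
  gyr : G → G → (G ≃+ G)
  gyr_assoc : ∀ x y z : G, x + (y + z) = (x + y) + gyr x y z
  gyr_loop : ∀ x y : G, gyr (x + y) y = gyr x y

namespace Gyrogroup

theorem eq_zero_of_identity {G : Type u} [Gyrogroup G] (e : G)
    (h : ∀ a : G, e + a = a ∧ a + e = a) : e = 0 :=
  (oplus_zero e).symm.trans (h 0).1

theorem left_cancel {G : Type u} [Gyrogroup G] {x a b : G} (h : x + a = x + b) : a = b := by
  have h2 : -x + (x + a) = -x + (x + b) := by rw [h]
  rw [gyr_assoc, gyr_assoc, neg_oplus, zero_oplus, zero_oplus] at h2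
  exact (gyr (-x) x).injective h2

theorem eq_neg_of_inverse {G : Type u} [Gyrogroup G] (x y : G)
    (h : y + x = 0 ∧ x + y = 0) : y = -x :=
  left_cancel (h.2.trans (oplus_neg x).symm)

end Gyrogroup

/-- A topological gyrogroup: the operation is jointly continuous and inversion is continuous. -/
class IsTopologicalGyrogroup (G : Type u) [TopologicalSpace G] [Gyrogroup G] : Prop
    extends ContinuousAdd G, ContinuousNeg G

/-- `𝒰` is a neighborhood base at `0` all of whose members are symmetric and invariant under every
gyration. A topological gyrogroup `G` with this property is a strongly topological gyrogroup with
symmetric neighborhood base `𝒰` at `0`. -/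
structure IsStrongSymmetricBase {G : Type u} [TopologicalSpace G] [Gyrogroup G]
    (𝒰 : Set (Set G)) : Prop where
  hasBasis : (𝓝 (0 : G)).HasBasis (fun U : Set G => U ∈ 𝒰) (fun U => U)
  symmetric : ∀ U ∈ 𝒰, (fun x : G => -x) '' U = U
  gyr_image : ∀ U ∈ 𝒰, ∀ x y : G, Gyrogroup.gyr x y '' U = U

/-- A subgyrogroup: a nonempty subset closed under the operation and inversion, such that the
gyrations by its elements restrict to automorphisms of it. -/
structure IsSubgyrogroup {G : Type u} [Gyrogroup G] (H : Set G) : Prop where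
  nonempty : H.Nonempty
  add_mem : ∀ a ∈ H, ∀ b ∈ H, a + b ∈ H
  neg_mem : ∀ a ∈ H, -a ∈ H
  gyr_image : ∀ a ∈ H, ∀ b ∈ H, Gyrogroup.gyr a b '' H = H

/-- `H` is an admissible subgyrogroup generated from `𝒰`: it is the intersection of a sequence of
open symmetric neighborhoods `V n ∈ 𝒰` of `0` with `V (n+1) ⊕ (V (n+1) ⊕ V (n+1)) ⊆ V n`. -/
def IsAdmissibleGeneratedFrom {G : Type u} [TopologicalSpace G] [Gyrogroup G]
    (H : Set G) (𝒰 : Set (Set G)) : Prop :=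
  IsSubgyrogroup H ∧ ∃ V : ℕ → Set G,
    (∀ n, V n ∈ 𝒰) ∧
    (∀ n, IsOpen (V n) ∧ (0 : G) ∈ V n ∧ (fun x : G => -x) '' V n = V n) ∧
    (∀ n, ∀ x ∈ V (n + 1), ∀ y ∈ V (n + 1), ∀ z ∈ V (n + 1), x + (y + z) ∈ V n) ∧
    H = ⋂ n, V n

/-- The left coset `a ⊕ H`. -/
def gyroCoset {G : Type u} [Gyrogroup G] (H : Set G) (a : G) : Set G :=
  (fun h => a + h) '' H

/-- The coset space `G/H = {a ⊕ H : a ∈ G}`. -/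
def GyroQuotient {G : Type u} [Gyrogroup G] (H : Set G) : Type u :=
  {A : Set G // ∃ a : G, gyroCoset H a = A}

/-- The natural map `π : G → G/H`, `a ↦ a ⊕ H`. -/
def GyroQuotient.mk {G : Type u} [Gyrogroup G] (H : Set G) (a : G) : GyroQuotient H :=
  ⟨gyroCoset H a, a, rfl⟩

/-- The quotient topology: `O ⊆ G/H` is open iff `π ⁻¹ (O)` is open in `G`. -/
instance GyroQuotient.instTopologicalSpace {G : Type u} [TopologicalSpace G] [Gyrogroup G]
    (H : Set G) : TopologicalSpace (GyroQuotient H) :=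
  TopologicalSpace.coinduced (GyroQuotient.mk H) inferInstance

/-- Strongly Fréchet–Urysohn spaces: whenever `x` lies in the closure of every term of a decreasing
sequence of sets `A n`, there are points `s n ∈ A n` with `s n → x`. -/
def StronglyFrechetUrysohn (X : Type u) [TopologicalSpace X] : Prop :=
  ∀ (x : X) (A : ℕ → Set X), Antitone A → x ∈ ⋂ n, closure (A n) →
    ∃ s : ℕ → X, (∀ n, s n ∈ A n) ∧ Tendsto s atTop (𝓝 x)

/-!
Left translations are homeomorphisms, so it is enough to treat the point `0`. Since `H` is
invariant under all gyrations of `G`, the map `π : G → G/H` is open, and if `π (x i) → π 0` then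
`x i` eventually lies in `N ⊕ H` for each neighborhood `N` of `0`.

Local compactness of `H` makes `π` perfect near `0`
(`exists_nhds_zero_forall_ultrafilter_clusters`): if an ultrafilter lives on a fixed small
neighborhood of `0` and its image under `π` converges to `π 0`, then it converges to a point of `H`.
First countability of `H` and regularity of `G` at `0` give a decreasing sequence of neighborhoods
`W n` of `0` whose closures meet `H` in `0` only (`exists_antitone_nhds_zero_inter_closure`).

Given `A n` decreasing with `0` in all closures, the strong Fréchet–Urysohn property of `G/H`
applied to the sets `π (A n ∩ W n)` produces points `s n ∈ A n ∩ W n` with `π (s n) → π 0`. Every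
ultrafilter finer than the sequence `s` converges to a point of `H ∩ ⋂ n, closure (W n) = {0}`,
so `s n → 0`.
-/

namespace Gyrogroup

variable {G : Type u} [Gyrogroup G]

theorem gyr_zero_left (x z : G) : gyr 0 x z = z := by
  have h := gyr_assoc 0 x z
  rw [zero_oplus, zero_oplus] at h
  exact (left_cancel h).symm

theorem neg_add_cancel_left' (x z : G) : -x + (x + z) = z := by
  rw [gyr_assoc, ← gyr_loop, neg_oplus, gyr_zero_left, zero_oplus]

theorem add_neg_cancel_left' (x z : G) : x + (-x + z) = z := by
  rw [gyr_assoc, ← gyr_loop, oplus_neg, gyr_zero_left, zero_oplus]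

theorem add_add_gyr_neg (x v : G) : (x + v) + gyr x v (-v) = x := by
  rw [← gyr_assoc, oplus_neg, oplus_zero]

/-- Left translation by `x`, as a homeomorphism. -/
def leftHomeomorph [TopologicalSpace G] [ContinuousAdd G] (x : G) : G ≃ₜ G where
  toFun z := x + z
  invFun z := -x + z
  left_inv z := neg_add_cancel_left' x z
  right_inv z := add_neg_cancel_left' x z
  continuous_toFun := continuous_const.add continuous_id
  continuous_invFun := continuous_const.add continuous_id

end Gyrogroup

open Gyrogroup

variable {G : Type u} [Gyrogroup G] {H : Set G}

theorem GyroQuotient.mem_gyroCoset_of_mk_eq (h0 : (0 : G) ∈ H) {a b : G}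
    (h : GyroQuotient.mk H a = GyroQuotient.mk H b) : b ∈ gyroCoset H a := by
  have hcoset : gyroCoset H a = gyroCoset H b := congrArg Subtype.val h
  rw [hcoset]
  exact ⟨0, h0, oplus_zero b⟩

theorem gyroCoset_add (hadd : ∀ a ∈ H, ∀ b ∈ H, a + b ∈ H) (hneg : ∀ a ∈ H, -a ∈ H)
    (hgyr : ∀ x y : G, gyr x y '' H = H) (x : G) {h : G} (hh : h ∈ H) :
    gyroCoset H (x + h) = gyroCoset H x := by
  apply Subset.antisymm
  · rintro _ ⟨k, hk, rfl⟩
    rw [← hgyr x h] at hk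
    obtain ⟨l, hl, rfl⟩ := hk
    exact ⟨h + l, hadd h hh l hl, gyr_assoc x h l⟩
  · rintro _ ⟨k, hk, rfl⟩
    refine ⟨gyr x h (-h + k), ?_, ?_⟩
    · rw [← hgyr x h]
      exact mem_image_of_mem _ (hadd _ (hneg h hh) k hk)
    · change (x + h) + gyr x h (-h + k) = x + k
      rw [← gyr_assoc, add_neg_cancel_left']

theorem gyr_image_iInter {ι : Type*} {V : ι → Set G} (x y : G)
    (hV : ∀ i, gyr x y '' V i = V i) : gyr x y '' (⋂ i, V i) = ⋂ i, V i := by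
  rw [image_iInter (gyr x y).bijective]
  exact iInter_congr hV

variable [TopologicalSpace G]

theorem GyroQuotient.continuous_mk : Continuous (GyroQuotient.mk H) :=
  continuous_coinduced_rng

/-- The saturation of `O` is `{x | ∃ h ∈ H, x ⊕ h ∈ O}`, a union of preimages of `O` under right
translations; this avoids having to know that right translations are open. -/
theorem GyroQuotient.isOpenMap_mk [ContinuousAdd G] (h0 : (0 : G) ∈ H)
    (hadd : ∀ a ∈ H, ∀ b ∈ H, a + b ∈ H) (hneg : ∀ a ∈ H, -a ∈ H)
    (hgyr : ∀ x y : G, gyr x y '' H = H) : IsOpenMap (GyroQuotient.mk H) := by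
  intro O hO
  change IsOpen (GyroQuotient.mk H ⁻¹' (GyroQuotient.mk H '' O))
  have key : GyroQuotient.mk H ⁻¹' (GyroQuotient.mk H '' O) =
      ⋃ h ∈ H, (fun x : G => x + h) ⁻¹' O := by
    ext x
    simp only [mem_preimage, mem_image, mem_iUnion, exists_prop]
    constructor
    · rintro ⟨o, ho, hox⟩
      obtain ⟨h, hh, hxo⟩ := GyroQuotient.mem_gyroCoset_of_mk_eq h0 hox.symm
      exact ⟨h, hh, by rwa [show x + h = o from hxo]⟩
    · rintro ⟨h, hh, hxo⟩
      exact ⟨x + h, hxo, Subtype.ext (gyroCoset_add hadd hneg hgyr x hh)⟩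
  rw [key]
  exact isOpen_biUnion fun h _ => hO.preimage (continuous_id.add continuous_const)

/-- Regularity at `0`: a member `U` of the base satisfies `closure U ⊆ U ⊕ U`. -/
theorem exists_nhds_zero_closure_subset [ContinuousAdd G] {𝒰 : Set (Set G)}
    (h𝒰 : IsStrongSymmetricBase 𝒰) {N : Set G} (hN : N ∈ 𝓝 (0 : G)) :
    ∃ U ∈ 𝓝 (0 : G), closure U ⊆ N := by
  have hcont : Tendsto (fun p : G × G => p.1 + p.2) (𝓝 0 ×ˢ 𝓝 0) (𝓝 0) := by
    have h := (continuous_fst.add continuous_snd : Continuous fun p : G × G => p.1 + p.2).tendsto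
      (0, 0)
    change Tendsto _ _ (𝓝 ((0 : G) + 0)) at h
    rwa [nhds_prod_eq, oplus_zero] at h
  obtain ⟨S, hS, hSN⟩ := (eventually_prod_self_iff (r := fun x y : G => x + y ∈ N)).1 (hcont hN)
  obtain ⟨U, hU, hUS⟩ := h𝒰.hasBasis.mem_iff.1 hS
  have hUn : U ∈ 𝓝 (0 : G) := h𝒰.hasBasis.mem_of_mem hU
  refine ⟨U, hUn, fun x hx => ?_⟩
  have hxU : (fun z => x + z) '' U ∈ 𝓝 x := by
    have h := (leftHomeomorph x).isOpenMap.image_mem_nhds hUn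
    rwa [show leftHomeomorph x 0 = x from oplus_zero x] at h
  obtain ⟨_, ⟨v, hv, rfl⟩, hu⟩ := mem_closure_iff_nhds.1 hx _ hxU
  have hv' : gyr x v (-v) ∈ U := by
    rw [← h𝒰.gyr_image U hU x v]
    refine mem_image_of_mem _ ?_
    rw [← h𝒰.symmetric U hU]
    exact mem_image_of_mem _ hv
  rw [← add_add_gyr_neg x v]
  exact hSN _ (hUS hu) _ (hUS hv')

theorem exists_antitone_nhds_zero_inter_closure [T1Space G] [ContinuousAdd G] {𝒰 : Set (Set G)}
    (h𝒰 : IsStrongSymmetricBase 𝒰) [(𝓝[H] (0 : G)).IsCountablyGenerated] :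
    ∃ W : ℕ → Set G, Antitone W ∧ (∀ n, W n ∈ 𝓝 (0 : G)) ∧
      ∀ p ∈ H, (∀ n, p ∈ closure (W n)) → p = 0 := by
  obtain ⟨B, hB⟩ := (𝓝[H] (0 : G)).exists_antitone_basis
  have hN : ∀ n, ∃ N ∈ 𝓝 (0 : G), N ∩ H ⊆ B n := fun n =>
    mem_nhdsWithin_iff_exists_mem_nhds_inter.1 (hB.mem n)
  choose N hN hNB using hN
  choose C hC hCN using fun n => exists_nhds_zero_closure_subset h𝒰 (hN n)
  refine ⟨fun n => ⋂ i ∈ Iic n, C i, ?_, ?_, ?_⟩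
  · intro m n hmn
    exact biInter_mono (Iic_subset_Iic.2 hmn) fun _ _ => Subset.rfl
  · intro n
    exact (biInter_mem (finite_Iic n)).2 fun i _ => hC i
  · intro p hp hpW
    by_contra hne
    have hmem : {p}ᶜ ∈ 𝓝[H] (0 : G) :=
      mem_nhdsWithin_of_mem_nhds (isOpen_compl_singleton.mem_nhds (Ne.symm hne))
    obtain ⟨n, -, hn⟩ := hB.toHasBasis.mem_iff.1 hmem
    have hpC : p ∈ closure (C n) :=
      closure_mono (biInter_subset_of_mem (mem_Iic.2 le_rfl)) (hpW n)
    exact hn (hNB n ⟨hCN n hpC, hp⟩) rfl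

/-- The quotient map is perfect near `0`: ultrafilters living near `0` whose images converge to the
coset of `0` converge to a point of `H`. -/
theorem exists_nhds_zero_forall_ultrafilter_clusters [IsTopologicalGyrogroup G]
    (h0 : (0 : G) ∈ H) (hopen : IsOpenMap (GyroQuotient.mk H)) [LocallyCompactSpace H] :
    ∃ W₀ ∈ 𝓝 (0 : G), ∀ F : Ultrafilter G, W₀ ∈ F →
      Tendsto (GyroQuotient.mk H) F (𝓝 (GyroQuotient.mk H 0)) → ∃ p ∈ H, (F : Filter G) ≤ 𝓝 p := by
  obtain ⟨L, hLc, hL⟩ := exists_compact_mem_nhds (⟨0, h0⟩ : H)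
  have hK : IsCompact (Subtype.val '' L : Set G) := hLc.image continuous_subtype_val
  have hKn : (Subtype.val '' L : Set G) ∈ 𝓝[H] (0 : G) := by
    rw [← map_nhds_subtype_val (⟨0, h0⟩ : H)]
    exact image_mem_map hL
  obtain ⟨M, hM, hMK⟩ := mem_nhdsWithin_iff_exists_mem_nhds_inter.1 hKn
  have hcont : Tendsto (fun p : G × G => -p.1 + p.2) (𝓝 0 ×ˢ 𝓝 0) (𝓝 0) := by
    have h := (continuous_fst.neg.add continuous_snd :
      Continuous fun p : G × G => -p.1 + p.2).tendsto (0, 0)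
    change Tendsto _ _ (𝓝 (-(0 : G) + 0)) at h
    rwa [nhds_prod_eq, neg_oplus] at h
  obtain ⟨W₀, hW₀, hWM⟩ :=
    (eventually_prod_self_iff (r := fun x y : G => -x + y ∈ M)).1 (hcont hM)
  refine ⟨W₀, hW₀, fun F hWF hF => ?_⟩
  by_contra! hnone
  -- Let `K` be the image of `L` in `G`. If no point of `K` is a limit of `F`, some open set `Q ⊇ K`
  -- does not belong to `F`. But `N ⊕ K ⊆ Q` for
  -- some neighborhood `N` of `0`, and `F` contains `((N ∩ W₀) ⊕ H) ∩ W₀`, which lies in `N ⊕ K`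
  -- since `⊖W₀ ⊕ W₀` meets `H` inside `K`.
  obtain ⟨Q, hQo, hKQ, hQF⟩ : ∃ Q : Set G, IsOpen Q ∧ Subtype.val '' L ⊆ Q ∧ Q ∉ F := by
    refine hK.induction_on (p := fun s => ∃ Q : Set G, IsOpen Q ∧ s ⊆ Q ∧ Q ∉ F)
      ⟨∅, isOpen_empty, Subset.rfl, F.empty_notMem⟩ ?_ ?_ ?_
    · rintro s t hst ⟨Q, hQ, htQ, hQF⟩
      exact ⟨Q, hQ, hst.trans htQ, hQF⟩
    · rintro s t ⟨Q, hQ, hsQ, hQF⟩ ⟨R, hR, htR, hRF⟩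
      refine ⟨Q ∪ R, hQ.union hR, union_subset_union hsQ htR, ?_⟩
      rw [Ultrafilter.union_mem_iff]
      tauto
    · rintro _ ⟨p, -, rfl⟩
      obtain ⟨O, hO, hOF⟩ := Filter.not_le.1 (hnone p p.2)
      obtain ⟨Q, hQO, hQ, hpQ⟩ := mem_nhds_iff.1 hO
      exact ⟨Q, mem_nhdsWithin_of_mem_nhds (hQ.mem_nhds hpQ), Q, hQ, Subset.rfl,
        fun h => hOF (mem_of_superset h hQO)⟩
  obtain ⟨N, T, hNo, -, h0N, hKT, hNT⟩ := generalized_tube_lemma (isCompact_singleton (x := (0 : G)))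
    hK (hQo.preimage (continuous_fst.add continuous_snd : Continuous fun p : G × G => p.1 + p.2))
    (by
      rintro ⟨a, k⟩ ⟨ha, hk⟩
      obtain rfl : a = 0 := ha
      exact show (0 : G) + k ∈ Q by rw [zero_oplus]; exact hKQ hk)
  have hsat : GyroQuotient.mk H ⁻¹' (GyroQuotient.mk H '' (N ∩ W₀)) ∈ F :=
    hF (hopen.image_mem_nhds (inter_mem (hNo.mem_nhds (h0N rfl)) hW₀))
  refine hQF (mem_of_superset (inter_mem hsat hWF) ?_)
  rintro x ⟨⟨n, ⟨hnN, hnW⟩, hnx⟩, hxW⟩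
  obtain ⟨h, hh, rfl⟩ := GyroQuotient.mem_gyroCoset_of_mk_eq h0 hnx
  have hM' : -n + (n + h) ∈ M := hWM n hnW _ hxW
  rw [neg_add_cancel_left'] at hM'
  exact hNT (mk_mem_prod hnN (hKT (hMK ⟨hM', hh⟩)))

theorem stronglyFrechetUrysohn_of_zero [ContinuousAdd G]
    (h : ∀ A : ℕ → Set G, Antitone A → (∀ n, (0 : G) ∈ closure (A n)) →
      ∃ s : ℕ → G, (∀ n, s n ∈ A n) ∧ Tendsto s atTop (𝓝 0)) : StronglyFrechetUrysohn G := by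
  intro x A hA hx
  obtain ⟨s, hs, hlim⟩ := h (fun n => leftHomeomorph x ⁻¹' A n)
    (fun m n hmn => preimage_mono (hA hmn)) (fun n => by
      rw [← (leftHomeomorph x).preimage_closure]
      change x + 0 ∈ closure (A n)
      rw [oplus_zero]
      exact mem_iInter.1 hx n)
  refine ⟨fun n => leftHomeomorph x (s n), hs, ?_⟩
  have hc := ((leftHomeomorph x).continuous.tendsto 0).comp hlim
  rwa [show leftHomeomorph x 0 = x from oplus_zero x] at hc

theorem mainTheorem7 {G : Type u} [TopologicalSpace G] [T2Space G] [Gyrogroup G]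
    [IsTopologicalGyrogroup G] (𝒰 : Set (Set G)) (h𝒰 : IsStrongSymmetricBase 𝒰)
    (H : Set G) (hH : IsAdmissibleGeneratedFrom H 𝒰)
    (hHlc : LocallyCompactSpace H) (hHm : TopologicalSpace.MetrizableSpace H)
    (hGH : StronglyFrechetUrysohn (GyroQuotient H)) :
    StronglyFrechetUrysohn G := by
  obtain ⟨hsub, V, hV𝒰, hV, -, hHV⟩ := hH
  have h0 : (0 : G) ∈ H := by
    rw [hHV]
    exact mem_iInter.2 fun n => (hV n).2.1
  have hgyr : ∀ x y : G, gyr x y '' H = H := by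
    intro x y
    rw [hHV]
    exact gyr_image_iInter x y fun n => h𝒰.gyr_image _ (hV𝒰 n) x y
  have hopen := GyroQuotient.isOpenMap_mk h0 hsub.add_mem hsub.neg_mem hgyr
  obtain ⟨W₀, hW₀, hperf⟩ := exists_nhds_zero_forall_ultrafilter_clusters h0 hopen
  have hfc : (𝓝[H] (0 : G)).IsCountablyGenerated := by
    let _ := TopologicalSpace.metrizableSpaceMetric H
    rw [← map_nhds_subtype_val (⟨0, h0⟩ : H)]
    infer_instance
  obtain ⟨W, hWanti, hWn, hW⟩ := exists_antitone_nhds_zero_inter_closure (H := H) h𝒰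
  refine stronglyFrechetUrysohn_of_zero fun A hA hA0 => ?_
  obtain ⟨y, hy, hylim⟩ := hGH (GyroQuotient.mk H 0)
    (fun n => GyroQuotient.mk H '' (A n ∩ (W n ∩ W₀)))
    (fun m n hmn => image_mono (inter_subset_inter (hA hmn)
      (inter_subset_inter_left _ (hWanti hmn))))
    (mem_iInter.2 fun n => by
      refine image_closure_subset_closure_image GyroQuotient.continuous_mk ⟨0, ?_, rfl⟩
      rw [mem_closure_iff_nhds]
      intro t ht
      obtain ⟨z, ⟨hzt, hzW⟩, hzA⟩ :=
        mem_closure_iff_nhds.1 (hA0 n) _ (inter_mem ht (inter_mem (hWn n) hW₀))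
      exact ⟨z, hzt, hzA, hzW⟩)
  choose s hs hsy using hy
  refine ⟨s, fun n => (hs n).1, ?_⟩
  rw [Tendsto, le_iff_ultrafilter]
  intro F hF
  obtain ⟨p, hpH, hFp⟩ := hperf F
    (hF (mem_map.2 (univ_mem' fun n => (hs n).2.2)))
    (Tendsto.mono_left (tendsto_map'_iff.2 (by simpa [Function.comp_def, hsy] using hylim)) hF)
  have hp0 : p = 0 := hW p hpH fun m => by
    refine mem_closure_iff_ultrafilter.2 ⟨F, hF ?_, hFp⟩
    exact mem_map.2 (mem_of_superset (Ici_mem_atTop m) fun n hn => hWanti hn (hs n).2.1)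
  rwa [hp0] at hFp
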